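/- Let $K$ be a field, let $n\ge 1$ be an integer, let $P(x)=x^n-1$ and let $Q(y)=\sum_{r=0}^{m}a_r y^r$ be a polynomial over $K$ of degree $m\ge 0$ ($a_m\neq 0$ not necessarily $1$). Assume that $P$ and $Q$ split into linear factors over $K$ (which is automatic for $K=\mathbb C$) and have no common zero. Let $x_1,\dots,x_n$ be the zeroes of $P$ and $y_1,\dots,y_m$ the zeroes of $Q$, listed with multiplicity, and let $$\mathrm{PER}(P,Q)=\mathrm{per}\Bigl(\frac1{x_i-y_j}\Bigr)_{1\le i\le n,\,1\le j\le m}=\sum_{f}\prod_{i=1}^n\frac{1}{x_i-y_{f(i)}},$$ where $f$ runs over all injections $\{1,\dots,n\}\to\{1,\dots,m\}$ (so that $\mathrm{PER}(P,Q)=0$ if $m<n$). For $r\ge 0$ let $r\%n$ be the number in $\{1,\dots,n\}$ congruent to $r$ modulo $n$, and for $1\le i\le n$ let $\mathrm{diag}_n^i(c_1,\dots,c_n)$ be the $n\times n$ matrix which, for each $q=1,\dots,n$, has the entry $c_q$ in column $q$ and in the row with number $q+i-1$ if $q+i-1\le n$, respectively $q+i-1-n$ if $q+i-1>n$, and whose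 other entries are $0$. Put $$\mathrm{Fes}(Q)=\det\Bigl(\sum_{r=0}^m \mathrm{diag}_n^{r\%n}\bigl(ra_r,(r-1)a_r,\dots,(r-n+1)a_r\bigr)\Bigr).$$ Then $\mathrm{Res}(P,Q)\ne0$ and $$\mathrm{PER}(P,Q)=\frac{\mathrm{Fes}(Q)}{\mathrm{Res}(P,Q)},$$ where $\mathrm{Res}(P,Q)=a_m^{n}\prod_{i=1}^n\prod_{j=1}^m(x_i-y_j)$ is the classical resultant of $P$ and $Q$. -/

import Mathlib

open Polynomial

/-- The permanent of a (not necessarily square) matrix: the sum of all products of entries in which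
exactly one entry is taken from every row and no two entries are taken from the same column.
In particular it is `0` if there are more rows than columns. -/
noncomputable def rectPermanent {ι κ R : Type*} [Fintype ι] [Fintype κ] [DecidableEq ι] [DecidableEq κ]
    [CommSemiring R] (A : Matrix ι κ R) : R :=
  ∑ f : ι ↪ κ, ∏ i, A i (f i)

open Classical in
/-- The Scott-type permanent `PER(P, Q)`: the permanent of the matrix `(1 / (x_i - y_j))`, where
`x_i` runs over the zeroes of `P` and `y_j` over the zeroes of `Q`. Both are listed with
multiplicity: the rows and columns are indexed by the elements of the root multisets, an element
that occurs `k` times giving `k` indices. It is meant for polynomials that split over `K` and have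
no common zero. -/
noncomputable def scottPermanent {K : Type*} [Field K] (P Q : K[X]) : K :=
  rectPermanent (Matrix.of fun (x : P.roots.ToType) (y : Q.roots.ToType) => 1 / (x.1 - y.1))

/-- `r % n` in the range `1, …, n`: the number between `1` and `n` congruent to `r` modulo `n`
(for `n ≥ 1`). -/
def resOne (r n : ℕ) : ℕ := if r % n = 0 then n else r % n

/-- The `n × n` broken diagonal matrix `diag_n^i(c_1, …, c_n)` for `1 ≤ i ≤ n`, whose diagonal
starts in the `i`-th row. With rows and columns numbered from `1`, the entry `c_q` is in column `q`
and in row `q + i - 1` if this is at most `n`, and in row `q + i - 1 - n` otherwise; all the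
other entries are `0`. In the code, `p`, `q` and the index of `c` are numbered from `0`. -/
def brokenDiag {R : Type*} [Zero R] (n i : ℕ) (c : Fin n → R) : Matrix (Fin n) (Fin n) R :=
  Matrix.of fun p q =>
    if (p : ℕ) + 1 = i + (q : ℕ) ∨ (p : ℕ) + 1 + n = i + (q : ℕ) then c q else 0

/-- `Fes(Q)`, for `Q = a_m y^m + ⋯ + a_0` of degree `m`: the determinant of
`∑_{r = 0}^m diag_n^{r % n}(r a_r, (r - 1) a_r, …, (r - n + 1) a_r)`. -/
noncomputable def fes {R : Type*} [CommRing R] (n : ℕ) (Q : R[X]) : R :=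
  (∑ r ∈ Finset.range (Q.natDegree + 1),
    brokenDiag n (resOne r n) fun k : Fin n => ((r : R) - ((k : ℕ) : R)) * Q.coeff r).det

/-! Both sides come from one linear map, g ↦ g Q' - g' Q modulo P on polynomials of degree less than
n. For P = X ^ n - 1 its matrix in the monomial basis is the matrix of `fes`
(`wronskianMatrix_X_pow_sub_one`).

If the zeroes x_i of P are distinct and Q(x_i) ≠ 0, the Lagrange basis at the x_i gives another
matrix for it. Up to diagonal conjugation and the factors Q(x_i), this is `nodeMatrix x` plus the
diagonal of Q'(x_i) / Q(x_i) (`det_wronskianMatrix_nodal`). When Q has zeroes y_j, these quotients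
are ∑ j, 1 / (x_i - y_j), and the determinant of the sum is the permanent. This is
`det_nodeMatrix_add_diagonal`, by induction on the number of y_j: partial fractions in the newest
y_j match the expansion of the permanent along its column.

Multiplying by ∏ Q(x_i), which is the resultant, clears denominators. The resulting identity is
polynomial, so it also holds when zeroes of P coincide, as they do if the characteristic divides n.
-/

namespace Matrix

/-! ### Determinants perturbed by a diagonal matrix -/

variable {ι R F : Type*} [Fintype ι] [DecidableEq ι] [CommRing R] [Field F]

theorem det_add_diagonal_eq_sum (A : Matrix ι ι R) (d : ι → R) :
    (A + diagonal d).det = ∑ s : Finset ι,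
      (∏ i ∈ s, d i) * (of fun i j => if i ∈ s then (1 : Matrix ι ι R) i j else A i j).det := by
  have h := (detRowAlternating (n := ι) (R := R)).map_add_univ (fun i => d i • Pi.single i 1) (fun i => A i)
  have h1 : ((fun i => d i • Pi.single i 1) + (fun i => A i) : ι → ι → R) = A + diagonal d := by
    ext i j
    rw [Pi.add_apply, Pi.add_apply, add_apply, add_comm]
    by_cases hij : i = j
    · subst hij; simp
    · simp [hij, Ne.symm hij]
  rw [h1] at h
  refine h.trans (Finset.sum_congr rfl fun s _ => ?_)
  have h2 := (detRowAlternating (n := ι) (R := R)).toMultilinearMap.map_piecewise_smul d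
    (s.piecewise (fun i => Pi.single i 1) (fun i => A i)) s
  rw [smul_eq_mul] at h2
  have h3 : (s.piecewise (fun i => d i • Pi.single i 1) (fun i => A i) : ι → ι → R) =
      s.piecewise (fun i => d i • (s.piecewise (fun i => Pi.single i 1) (fun i => A i) : ι → ι → R) i)
        (s.piecewise (fun i => Pi.single i 1) (fun i => A i)) := by
    ext i j
    by_cases hi : i ∈ s <;> simp [hi]
  have h4 : (of fun i j => if i ∈ s then (1 : Matrix ι ι R) i j else A i j) =
      of (s.piecewise (fun i => Pi.single i 1) (fun i => A i)) := by
    ext i j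
    by_cases hi : i ∈ s <;> simp [hi, one_apply, Pi.single_apply, eq_comm]
  rw [h3, h4]
  exact h2

/-- Replacing row i by a unit vector amounts to clearing row i of A and setting d i = 1. The subsets
missing i then contribute a zero row. -/
theorem adjugate_add_diagonal_diag_eq_sum (A : Matrix ι ι R) (d : ι → R) (i : ι) :
    (A + diagonal d).adjugate i i = ∑ s : Finset ι, if i ∈ s then
      (∏ k ∈ s.erase i, d k) * (of fun l j => if l ∈ s then (1 : Matrix ι ι R) l j else A l j).det else 0 := by
  have h : (A + diagonal d).updateRow i (Pi.single i 1) =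
      A.updateRow i 0 + diagonal (Function.update d i 1) := by
    ext k l
    by_cases hk : k = i
    · subst hk
      by_cases hl : k = l
      · subst hl; simp
      · simp [hl, Ne.symm hl]
    · simp [hk, diagonal_apply]
  rw [adjugate_apply, h, det_add_diagonal_eq_sum]
  refine Finset.sum_congr rfl fun s _ => ?_
  split_ifs with hi
  · congr 1
    · rw [← Finset.mul_prod_erase s _ hi, Function.update_self, one_mul]
      refine Finset.prod_congr rfl fun k hk => ?_
      rw [Function.update_of_ne (Finset.ne_of_mem_erase hk)]
    · congr 1
      ext k l
      by_cases hk : k ∈ s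
      · simp [hk]
      · have : k ≠ i := fun h => hk (h ▸ hi)
        simp [hk, this, updateRow_apply]
  · rw [det_eq_zero_of_row_eq_zero i, mul_zero]
    intro j
    simp [hi, updateRow_apply]

/-- Partial fractions in w: the Lagrange basis polynomials sum to 1, and this is evaluated at w. -/
theorem prod_inv_sub_eq_sum {ι : Type*} [DecidableEq ι] (x : ι → F) (hx : Function.Injective x) (w : F) (hw : ∀ i, x i ≠ w)
    (s : Finset ι) (hs : s.Nonempty) :
    ∏ i ∈ s, (x i - w)⁻¹ =
      ∑ i ∈ s, (x i - w)⁻¹ * ∏ k ∈ s.erase i, (x k - x i)⁻¹ := by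
  have h := congrArg (eval w) (Lagrange.sum_basis (s := s) (v := x) hx.injOn hs)
  rw [eval_finsetSum, eval_one] at h
  rw [← mul_one (∏ i ∈ s, (x i - w)⁻¹), ← h, Finset.mul_sum]
  refine Finset.sum_congr rfl fun i hi => ?_
  rw [← Finset.mul_prod_erase s _ hi, mul_assoc, Lagrange.basis, eval_prod,
    ← Finset.prod_mul_distrib]
  congr 1
  refine Finset.prod_congr rfl fun k hk => ?_
  have h1 : x k - w ≠ 0 := sub_ne_zero.2 (hw k)
  have h2 : x k - x i ≠ 0 := sub_ne_zero.2 (hx.ne (Finset.ne_of_mem_erase hk))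
  have h3 : x i - x k ≠ 0 := sub_ne_zero.2 (hx.ne (Finset.ne_of_mem_erase hk).symm)
  simp only [Lagrange.basisDivisor, eval_mul, eval_C, eval_sub, eval_X]
  field_simp
  ring

/-- As a function of w the determinant has only simple poles, at the x i. Partial fractions for each
subset term collect into residues that are principal minors. The entry k = i of the inner diagonal
is irrelevant, since row i is deleted. -/
theorem det_add_diagonal_inv_sub (A : Matrix ι ι F) (x : ι → F) (hx : Function.Injective x)
    (w : F) (hw : ∀ i, x i ≠ w) :
    (A + diagonal fun i => (x i - w)⁻¹).det =
      A.det + ∑ i, (x i - w)⁻¹ * (A + diagonal fun k => (x k - x i)⁻¹).adjugate i i := by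
  simp_rw [adjugate_add_diagonal_diag_eq_sum, Finset.mul_sum]
  rw [Finset.sum_comm, det_add_diagonal_eq_sum,
    ← Finset.add_sum_erase Finset.univ _ (Finset.mem_univ (∅ : Finset ι)),
    ← Finset.add_sum_erase Finset.univ (fun s : Finset ι => ∑ i, _) (Finset.mem_univ (∅ : Finset ι))]
  congr 1
  · simp
    rfl
  · simp only [Finset.notMem_empty, if_false, mul_zero, Finset.sum_const_zero, zero_add]
    refine Finset.sum_congr rfl fun s hs => ?_
    rw [prod_inv_sub_eq_sum x hx w hw s
      (Finset.nonempty_iff_ne_empty.2 (Finset.ne_of_mem_erase hs)), Finset.sum_mul,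
      ← Finset.sum_subset (Finset.subset_univ s)]
    · refine Finset.sum_congr rfl fun i hi => ?_
      rw [if_pos hi, mul_assoc]
    · intro i _ hi
      rw [if_neg hi, mul_zero]

end Matrix

/-! ### Expansion of a rectangular permanent along one column -/

/-- The embeddings of `Fin (n + 1)` into `Option κ` taking the value `none` at `i` are the
embeddings of `Fin n` into `κ`. -/
def Function.Embedding.insertNone {κ : Type*} {n : ℕ} (i : Fin (n + 1)) (g : Fin n ↪ κ) :
    Fin (n + 1) ↪ Option κ where
  toFun := i.insertNth (α := fun _ => Option κ) none (fun k => some (g k))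
  inj' := by
    intro a b
    refine Fin.succAboveCases i ?_ (fun a => ?_) a <;>
      refine Fin.succAboveCases i ?_ (fun b => ?_) b <;> simp

theorem Function.Embedding.insertNone_apply {κ : Type*} {n : ℕ} (i : Fin (n + 1)) (g : Fin n ↪ κ)
    (k : Fin (n + 1)) : Function.Embedding.insertNone i g k =
      i.insertNth (α := fun _ => Option κ) none (fun k => some (g k)) k :=
  rfl

@[simp]
theorem Function.Embedding.insertNone_self {κ : Type*} {n : ℕ} (i : Fin (n + 1)) (g : Fin n ↪ κ) :
    Function.Embedding.insertNone i g i = none := by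
  simp [Function.Embedding.insertNone_apply]

@[simp]
theorem Function.Embedding.insertNone_succAbove {κ : Type*} {n : ℕ} (i : Fin (n + 1))
    (g : Fin n ↪ κ) (k : Fin n) :
    Function.Embedding.insertNone i g (i.succAbove k) = some (g k) := by
  simp [Function.Embedding.insertNone_apply]

theorem sum_embedding_option_eq {κ R : Type*} [Fintype κ] [DecidableEq κ] [CommRing R] {n : ℕ}
    (A : Fin (n + 1) → Option κ → R) :
    ∑ f : Fin (n + 1) ↪ Option κ, ∏ i, A i (f i) =
      ∑ f : Fin (n + 1) ↪ κ, ∏ i, A i (some (f i)) +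
        ∑ i, A i none * ∑ g : Fin n ↪ κ, ∏ k, A (i.succAbove k) (some (g k)) := by
  rw [← Finset.sum_filter_add_sum_filter_not Finset.univ
    (fun f : Fin (n + 1) ↪ Option κ => ∀ i, f i ≠ none)]
  congr 1
  · symm
    refine Finset.sum_bij (fun f _ => f.trans Function.Embedding.some) ?_ ?_ ?_ ?_
    · intro f _; simp
    · intro f _ g _ h
      ext i
      simpa using DFunLike.congr_fun h i
    · intro f hf
      simp only [Finset.mem_filter, Finset.mem_univ, true_and] at hf
      choose g hg using fun i => Option.ne_none_iff_exists'.1 (hf i)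
      refine ⟨⟨g, fun a b hab => f.injective (by rw [hg, hg, hab])⟩, Finset.mem_univ _, ?_⟩
      ext1 i
      exact (hg i).symm
    · intro f _; simp
  · simp_rw [Finset.mul_sum]
    rw [← Finset.sum_product' (f := fun (i : Fin (n + 1)) (g : Fin n ↪ κ) =>
      A i none * ∏ k, A (i.succAbove k) (some (g k)))]
    symm
    refine Finset.sum_bij (fun p _ => Function.Embedding.insertNone p.1 p.2) ?_ ?_ ?_ ?_
    · rintro ⟨i, g⟩ _
      simp only [Finset.mem_filter, Finset.mem_univ, true_and, not_forall, not_not]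
      exact ⟨i, by simp⟩
    · rintro ⟨i, g⟩ _ ⟨j, h⟩ _ hgh
      have hij : i = j := by
        by_contra hne
        obtain ⟨k, rfl⟩ := Fin.exists_succAbove_eq (Ne.symm hne)
        have := DFunLike.congr_fun hgh (i.succAbove k)
        rw [Function.Embedding.insertNone_succAbove, Function.Embedding.insertNone_self] at this
        exact Option.some_ne_none _ this
      subst hij
      congr 1
      ext k
      simpa using DFunLike.congr_fun hgh (i.succAbove k)
    · intro f hf
      simp only [Finset.mem_filter, Finset.mem_univ, true_and, not_forall, not_not] at hf
      obtain ⟨i, hi⟩ := hf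
      have hk : ∀ k, f (i.succAbove k) ≠ none := fun k h =>
        Fin.succAbove_ne i k (f.injective (h.trans hi.symm))
      choose g hg using fun k => Option.ne_none_iff_exists'.1 (hk k)
      refine ⟨(i, ⟨g, fun a b hab => Fin.succAbove_right_injective
        (f.injective (by rw [hg, hg, hab]))⟩), Finset.mem_univ _, ?_⟩
      ext1 a
      refine Fin.succAboveCases i ?_ (fun k => ?_) a
      · simp [hi]
      · exact (Function.Embedding.insertNone_succAbove _ _ _).trans (hg k).symm
    · rintro ⟨i, g⟩ _
      rw [Fin.prod_univ_succAbove _ i]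
      simp

/-! ### The permanent as a determinant -/

namespace Matrix

variable {F : Type*} [Field F]

/-- The matrix with entries `1 / (x_k - x_i)` off the diagonal and with vanishing column sums. -/
def nodeMatrix {n : ℕ} (x : Fin n → F) : Matrix (Fin n) (Fin n) F :=
  of (fun i k => (x k - x i)⁻¹) + diagonal fun i => ∑ l, (x l - x i)⁻¹

theorem det_nodeMatrix_succ {n : ℕ} (x : Fin (n + 1) → F) : (nodeMatrix x).det = 0 := by
  by_contra h
  have h1 : (1 : Fin (n + 1) → F) ᵥ* nodeMatrix x = 0 := by
    ext k
    rw [nodeMatrix, vecMul_add, Pi.add_apply, vecMul_diagonal]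
    simp only [vecMul, dotProduct, Pi.one_apply, one_mul, of_apply, Pi.zero_apply]
    rw [← Finset.sum_add_distrib]
    refine Finset.sum_eq_zero fun i _ => ?_
    rw [← neg_sub, inv_neg, neg_add_cancel]
  exact one_ne_zero (congrFun (eq_zero_of_vecMul_eq_zero h h1) 0)

/-- The deleted node's term in each diagonal sum is cancelled by the added `(x k - x i)⁻¹`, so the
residues have the same shape with one node fewer. -/
theorem submatrix_nodeMatrix_add_diagonal {n : ℕ} (x : Fin (n + 1) → F) (s : Fin (n + 1) → F)
    (i : Fin (n + 1)) :
    (nodeMatrix x + diagonal s + diagonal fun k => (x k - x i)⁻¹).submatrix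
      i.succAbove i.succAbove =
      nodeMatrix (x ∘ i.succAbove) + diagonal (s ∘ i.succAbove) := by
  ext k l
  by_cases hkl : k = l
  · subst hkl
    simp only [nodeMatrix, submatrix_apply, add_apply, of_apply, diagonal_apply_eq,
      Function.comp_apply]
    rw [Fin.sum_univ_succAbove _ i, ← neg_sub (x (i.succAbove k)) (x i), inv_neg]
    ring
  · have : i.succAbove k ≠ i.succAbove l := Fin.succAbove_right_injective.ne hkl
    simp [nodeMatrix, hkl]

theorem det_nodeMatrix_add_diagonal (κ : Type*) [Fintype κ] [DecidableEq κ] :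
    ∀ (n : ℕ) (x : Fin n → F) (y : κ → F), Function.Injective x → (∀ i j, x i ≠ y j) →
      (nodeMatrix x + diagonal fun i => ∑ j, (x i - y j)⁻¹).det =
        ∑ f : Fin n ↪ κ, ∏ i, (x i - y (f i))⁻¹ := by
  classical
  refine Fintype.induction_empty_option (P := fun κ _ => ∀ (n : ℕ) (x : Fin n → F) (y : κ → F),
      Function.Injective x → (∀ i j, x i ≠ y j) →
      (nodeMatrix x + diagonal fun i => ∑ j, (x i - y j)⁻¹).det =
        ∑ f : Fin n ↪ κ, ∏ i, (x i - y (f i))⁻¹) ?_ ?_ ?_ κ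
  · intro α β _ e ih n x y hx hxy
    let _ := Fintype.ofEquiv β e.symm
    have := ih n x (y ∘ e) hx (fun i j => hxy i _)
    simp_rw [Function.comp_apply, fun i => e.sum_comp (fun j => (x i - y j)⁻¹)] at this
    rw [this]
    exact Fintype.sum_equiv (Equiv.embeddingCongr (Equiv.refl _) e) _ _ (fun f => by simp)
  · intro n x y hx hxy
    cases n with
    | zero => simp
    | succ n =>
      rw [Finset.sum_eq_zero fun f _ => (f 0).elim]
      simp [det_nodeMatrix_succ]
  · intro κ _ ih n x y hx hxy
    cases n with
    | zero => simp
    | succ n =>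
      rw [sum_embedding_option_eq (fun i j => (x i - y j)⁻¹),
        ← ih (n + 1) x (fun j => y (some j)) hx (fun i j => hxy i _)]
      have h1 : (diagonal fun i => ∑ j, (x i - y j)⁻¹) =
          (diagonal fun i => ∑ j, (x i - y (some j))⁻¹) +
            diagonal fun i => (x i - y none)⁻¹ := by
        rw [diagonal_add]
        congr 1
        ext i
        rw [Fintype.sum_option, add_comm]
      rw [h1, ← add_assoc, det_add_diagonal_inv_sub _ x hx (y none) (fun i => hxy i _)]
      congr 1
      refine Finset.sum_congr rfl fun i _ => ?_
      rw [adjugate_fin_succ_eq_det_submatrix, submatrix_nodeMatrix_add_diagonal,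
        Even.neg_one_pow (by simp), one_mul]
      congr 1
      exact ih n (x ∘ i.succAbove) (fun j => y (some j))
        (hx.comp Fin.succAbove_right_injective) (fun i j => hxy _ _)

end Matrix

/-! ### Derivatives of the Lagrange basis at the nodes -/

theorem Lagrange.eval_derivative_eq_sum {F ι : Type*} [Field F] [Fintype ι] [DecidableEq ι]
    (x : ι → F) (hx : Function.Injective x) (g : F[X]) (hg : g.degree < Fintype.card ι) (a : F) :
    eval a (derivative g) =
      ∑ k, eval a (derivative (Lagrange.basis Finset.univ x k)) * eval (x k) g := by
  conv_lhs => rw [Lagrange.eq_interpolate (s := Finset.univ) hx.injOn hg]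
  rw [Lagrange.interpolate_apply, derivative_sum, eval_finsetSum]
  refine Finset.sum_congr rfl fun k _ => ?_
  rw [derivative_C_mul, eval_mul, eval_C, mul_comm]

theorem Lagrange.eval_derivative_basis_self {F ι : Type*} [Field F] [Fintype ι] [DecidableEq ι]
    (x : ι → F) (hx : Function.Injective x) (k : ι) :
    eval (x k) (derivative (Lagrange.basis Finset.univ x k)) = ∑ l, (x k - x l)⁻¹ := by
  -- The term l = k is harmless because `0⁻¹ = 0`.
  rw [Lagrange.basis, derivative_prod_finset, eval_finsetSum,
    ← Finset.add_sum_erase Finset.univ (fun l => (x k - x l)⁻¹) (Finset.mem_univ k), sub_self,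
    inv_zero, zero_add]
  refine Finset.sum_congr rfl fun l hl => ?_
  rw [eval_mul, eval_prod, Finset.prod_eq_one]
  · simp [Lagrange.basisDivisor]
  · intro j hj
    exact Lagrange.eval_basisDivisor_left_of_ne
      (hx.ne (Finset.ne_of_mem_erase (Finset.mem_of_mem_erase hj)).symm)

theorem Lagrange.eval_derivative_nodal_ne_zero {F ι : Type*} [Field F] [Fintype ι] [DecidableEq ι]
    (x : ι → F) (hx : Function.Injective x) (k : ι) :
    eval (x k) (derivative (Lagrange.nodal Finset.univ x)) ≠ 0 := by
  rw [Lagrange.eval_nodal_derivative_eval_node_eq (Finset.mem_univ k), Lagrange.eval_nodal,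
    Finset.prod_ne_zero_iff]
  exact fun l hl => sub_ne_zero.2 (hx.ne (Finset.ne_of_mem_erase hl).symm)

/-- With P the nodal polynomial and L_k the basis polynomial, differentiate P'(x_k) (X - x_k) L_k =
P at x_i, where L_k vanishes. -/
theorem Lagrange.eval_derivative_basis_of_ne {F ι : Type*} [Field F] [Fintype ι] [DecidableEq ι]
    (x : ι → F) (hx : Function.Injective x) {i k : ι} (hik : i ≠ k) :
    eval (x i) (derivative (Lagrange.basis Finset.univ x k)) =
      eval (x i) (derivative (Lagrange.nodal Finset.univ x)) * (x i - x k)⁻¹ *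
        (eval (x k) (derivative (Lagrange.nodal Finset.univ x)))⁻¹ := by
  have h1 : x i - x k ≠ 0 := sub_ne_zero.2 (hx.ne hik)
  have h2 := Lagrange.eval_derivative_nodal_ne_zero x hx k
  have h3 : C (eval (x k) (derivative (Lagrange.nodal Finset.univ x))) *
      ((X - C (x k)) * Lagrange.basis Finset.univ x k) = Lagrange.nodal Finset.univ x := by
    rw [Lagrange.basis_eq_prod_sub_inv_mul_nodal_div (Finset.mem_univ k),
      Lagrange.nodalWeight_eq_eval_derivative_nodal (Finset.mem_univ k), mul_left_comm (X - C (x k)),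
      ← mul_assoc, ← C_mul, mul_inv_cancel₀ h2, C_1, one_mul,
      EuclideanDomain.mul_div_cancel' (X_sub_C_ne_zero _)
        (Lagrange.X_sub_C_dvd_nodal x (Finset.mem_univ k))]
  have h4 := congrArg (fun p => eval (x i) (derivative p)) h3
  simp only [derivative_mul, derivative_sub, derivative_X, derivative_C, sub_zero,
    one_mul, eval_mul, eval_add, eval_sub, eval_X, eval_C,
    Lagrange.eval_basis_of_ne hik.symm (Finset.mem_univ i), zero_add, zero_mul] at h4
  rw [← h4]
  field_simp

theorem Lagrange.nodal_map {ι A B : Type*} [CommRing A] [CommRing B] (φ : A →+* B) (s : Finset ι)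
    (v : ι → A) : (Lagrange.nodal s v).map φ = Lagrange.nodal s fun i => φ (v i) := by
  simp [Lagrange.nodal, Polynomial.map_prod]

/-! ### The Wronskian map modulo P -/

/-- The matrix, in the basis `1, X, …, X ^ (n - 1)`, of the map `g ↦ g Q' - g' Q` from the
polynomials of degree less than `n` to the quotient by the monic polynomial `P` of degree `n`. -/
noncomputable def wronskianMatrix {R : Type*} [CommRing R] (n : ℕ) (P Q : R[X]) :
    Matrix (Fin n) (Fin n) R :=
  Matrix.of fun p q => (wronskian (X ^ (q : ℕ)) Q %ₘ P).coeff p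

theorem wronskianMatrix_map {R S : Type*} [CommRing R] [CommRing S] (φ : R →+* S) (n : ℕ)
    (P Q : R[X]) (hP : P.Monic) :
    (wronskianMatrix n P Q).map φ = wronskianMatrix n (P.map φ) (Q.map φ) := by
  ext p q
  simp only [wronskianMatrix, Matrix.map_apply, Matrix.of_apply]
  rw [← coeff_map, map_modByMonic _ hP]
  simp only [wronskian, Polynomial.map_sub, Polynomial.map_mul, ← derivative_map,
    Polynomial.map_pow, map_X]

theorem wronskianMatrix_C_mul {R : Type*} [CommRing R] (n : ℕ) (P Q : R[X]) (a : R) :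
    wronskianMatrix n P (C a * Q) = a • wronskianMatrix n P Q := by
  ext p q
  have : wronskian (X ^ (q : ℕ)) (C a * Q) = a • wronskian (X ^ (q : ℕ)) Q := by
    rw [smul_eq_C_mul, wronskian, wronskian, derivative_C_mul]
    ring
  simp [wronskianMatrix, this, smul_modByMonic]

namespace Matrix

theorem det_wronskianMatrix_nodal {F : Type*} [Field F] {n : ℕ} (x : Fin n → F)
    (hx : Function.Injective x) (Q : F[X]) (hQ : ∀ i, eval (x i) Q ≠ 0) :
    (wronskianMatrix n (Lagrange.nodal Finset.univ x) Q).det = (∏ i, eval (x i) Q) *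
      (nodeMatrix x + diagonal fun i => eval (x i) (derivative Q) / eval (x i) Q).det := by
  set w : Fin n → F := fun i => eval (x i) (derivative (Lagrange.nodal Finset.univ x)) with hw
  have hw0 : ∀ i, w i ≠ 0 := Lagrange.eval_derivative_nodal_ne_zero x hx
  set M := nodeMatrix x + diagonal fun i => eval (x i) (derivative Q) / eval (x i) Q with hM
  have hV : (vandermonde x).det ≠ 0 := det_vandermonde_ne_zero_iff.2 hx
  have hentry : ∀ i k, (diagonal (fun i => eval (x i) Q) * (diagonal w * M * diagonal (fun k => (w k)⁻¹))) i k
      = (if i = k then eval (x i) (derivative Q) else 0) -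
        eval (x i) Q * eval (x i) (derivative (Lagrange.basis Finset.univ x k)) := by
    intro i k
    rw [diagonal_mul, mul_diagonal, diagonal_mul]
    have := hQ i
    have := hw0 i
    by_cases hik : i = k
    · subst hik
      rw [Lagrange.eval_derivative_basis_self x hx]
      have h : ∑ l, (x l - x i)⁻¹ = - ∑ l, (x i - x l)⁻¹ := by
        rw [← Finset.sum_neg_distrib]
        refine Finset.sum_congr rfl fun l _ => ?_
        rw [← inv_neg, neg_sub]
      simp only [hM, nodeMatrix, add_apply, of_apply, sub_self, diagonal_apply_eq, h,
        if_true]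
      field_simp
      ring
    · rw [Lagrange.eval_derivative_basis_of_ne x hx hik]
      simp only [hM, nodeMatrix, add_apply, of_apply, diagonal_apply_ne _ hik, if_neg hik]
      rw [← neg_sub (x i), inv_neg]
      simp only [hw]
      ring
  -- Change of basis: the Vandermonde matrix takes coefficients to values at the nodes, and
  -- reduction modulo P preserves those values.
  have hmul : vandermonde x * wronskianMatrix n (Lagrange.nodal Finset.univ x) Q =
      (diagonal (fun i => eval (x i) Q) * (diagonal w * M * diagonal (fun k => (w k)⁻¹))) *
        vandermonde x := by
    ext i q
    have hmonic : (Lagrange.nodal Finset.univ x).Monic := Lagrange.nodal_monic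
    rw [mul_apply, mul_apply]
    simp_rw [hentry]
    have hl : ∑ p, vandermonde x i p * wronskianMatrix n (Lagrange.nodal Finset.univ x) Q p q =
        eval (x i) (wronskian (X ^ (q : ℕ)) Q) := by
      set W := wronskian (X ^ (q : ℕ)) Q
      have h1 : eval (x i) W = eval (x i) (W %ₘ Lagrange.nodal Finset.univ x) := by
        conv_lhs => rw [← modByMonic_add_div W (Lagrange.nodal Finset.univ x)]
        rw [eval_add, eval_mul, Lagrange.eval_nodal_at_node (Finset.mem_univ i), zero_mul, add_zero]
      have h2 : (W %ₘ Lagrange.nodal Finset.univ x).natDegree < n := by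
        have := i.pos
        have h := natDegree_modByMonic_lt W hmonic (by
          intro h
          have := congrArg natDegree h
          rw [Lagrange.natDegree_nodal] at this
          simp at this
          omega)
        simpa [Lagrange.natDegree_nodal] using h
      rw [h1, eval_eq_sum_range' h2, Finset.sum_range]
      refine Finset.sum_congr rfl fun p _ => ?_
      rw [vandermonde_apply, mul_comm]
      rfl
    rw [hl, wronskian, eval_sub, eval_mul, eval_mul,
      Lagrange.eval_derivative_eq_sum x hx (X ^ (q : ℕ)) (by
        rw [degree_X_pow, Fintype.card_fin]; exact_mod_cast q.2)]
    simp_rw [sub_mul, Finset.sum_sub_distrib, ite_mul, zero_mul, vandermonde_apply, eval_pow, eval_X,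
      Finset.sum_ite_eq, Finset.mem_univ, if_true, mul_assoc, ← Finset.mul_sum]
    ring
  have hdet := congrArg det hmul
  simp only [det_mul, det_diagonal, Finset.prod_inv_distrib] at hdet
  have hw1 : ∏ i, w i ≠ 0 := Finset.prod_ne_zero_iff.2 fun i _ => hw0 i
  refine mul_left_cancel₀ hV (hdet.trans ?_)
  field_simp

theorem eval_derivative_nodal_div {F κ : Type*} [Field F] [Fintype κ] [DecidableEq κ]
    (y : κ → F) (a : F) (ha : ∀ j, a ≠ y j) :
    eval a (derivative (Lagrange.nodal Finset.univ y)) / eval a (Lagrange.nodal Finset.univ y) =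
      ∑ j, (a - y j)⁻¹ := by
  have h : ∀ j, a - y j ≠ 0 := fun j => sub_ne_zero.2 (ha j)
  rw [Lagrange.derivative_nodal, eval_finsetSum, Finset.sum_div]
  refine Finset.sum_congr rfl fun j _ => ?_
  have h1 : eval a (Lagrange.nodal (Finset.univ.erase j) y) ≠ 0 := by
    rw [Lagrange.eval_nodal, Finset.prod_ne_zero_iff]
    exact fun j _ => h j
  rw [Lagrange.nodal_eq_mul_nodal_erase (Finset.mem_univ j), eval_mul, eval_sub, eval_X, eval_C]
  have := h j
  field_simp

theorem det_wronskianMatrix_nodal_nodal_of_field {F κ : Type*} [Field F] [Fintype κ]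
    [DecidableEq κ] {n : ℕ} (x : Fin n → F) (y : κ → F) (hx : Function.Injective x)
    (hxy : ∀ i j, x i ≠ y j) :
    (wronskianMatrix n (Lagrange.nodal Finset.univ x) (Lagrange.nodal Finset.univ y)).det =
      ∑ f : Fin n ↪ κ, ∏ i, ∏ j ∈ Finset.univ.erase (f i), (x i - y j) := by
  have h : ∀ i j, x i - y j ≠ 0 := fun i j => sub_ne_zero.2 (hxy i j)
  rw [det_wronskianMatrix_nodal x hx]
  · simp_rw [eval_derivative_nodal_div y _ (hxy _)]
    rw [det_nodeMatrix_add_diagonal κ n x y hx hxy, Finset.mul_sum]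
    refine Finset.sum_congr rfl fun f _ => ?_
    rw [← Finset.prod_mul_distrib]
    refine Finset.prod_congr rfl fun i _ => ?_
    rw [Lagrange.eval_nodal, ← Finset.mul_prod_erase _ _ (Finset.mem_univ (f i)), mul_comm,
      inv_mul_cancel_left₀ (h _ _)]
  · intro i
    rw [Lagrange.eval_nodal, Finset.prod_ne_zero_iff]
    exact fun j _ => h i j

/-- Both sides are integer polynomials in the x i and y j. The field case applies to indeterminates,
and specialization gives every commutative ring, with coincidences allowed. -/
theorem det_wronskianMatrix_nodal_nodal {R κ : Type*} [CommRing R] [Fintype κ] [DecidableEq κ]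
    {n : ℕ} (x : Fin n → R) (y : κ → R) :
    (wronskianMatrix n (Lagrange.nodal Finset.univ x) (Lagrange.nodal Finset.univ y)).det =
      ∑ f : Fin n ↪ κ, ∏ i, ∏ j ∈ Finset.univ.erase (f i), (x i - y j) := by
  let S := MvPolynomial (Fin n ⊕ κ) ℤ
  let u : Fin n → S := fun i => MvPolynomial.X (Sum.inl i)
  let v : κ → S := fun j => MvPolynomial.X (Sum.inr j)
  have key : (wronskianMatrix n (Lagrange.nodal Finset.univ u) (Lagrange.nodal Finset.univ v)).det =
      ∑ f : Fin n ↪ κ, ∏ i, ∏ j ∈ Finset.univ.erase (f i), (u i - v j) := by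
    have hinj := IsFractionRing.injective S (FractionRing S)
    apply hinj
    have := det_wronskianMatrix_nodal_nodal_of_field (fun i => algebraMap S (FractionRing S) (u i))
      (fun j => algebraMap S (FractionRing S) (v j))
      (hinj.comp ((MvPolynomial.X_injective).comp Sum.inl_injective))
      (fun i j h => by simpa using MvPolynomial.X_injective (hinj h))
    rw [RingHom.map_det, RingHom.mapMatrix_apply, wronskianMatrix_map _ _ _ _ Lagrange.nodal_monic,
      Lagrange.nodal_map, Lagrange.nodal_map, this]
    simp_rw [map_sum, map_prod, map_sub]
  let φ : S →+* R := MvPolynomial.eval₂Hom (Int.castRingHom R) (Sum.elim x y)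
  have hu : ∀ i, φ (u i) = x i := fun i => MvPolynomial.eval₂Hom_X' _ _ _
  have hv : ∀ j, φ (v j) = y j := fun j => MvPolynomial.eval₂Hom_X' _ _ _
  have := congrArg φ key
  rw [RingHom.map_det, RingHom.mapMatrix_apply, wronskianMatrix_map _ _ _ _ Lagrange.nodal_monic,
    Lagrange.nodal_map, Lagrange.nodal_map] at this
  simp_rw [map_sum, map_prod, map_sub, hu, hv] at this
  exact this

end Matrix

/-! ### Broken diagonals from reduction modulo X ^ n - 1 -/

theorem X_pow_modByMonic_X_pow_sub_one {R : Type*} [CommRing R] {n : ℕ} (hn : n ≠ 0) (s : ℕ) :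
    (X ^ s : R[X]) %ₘ (X ^ n - 1) = X ^ (s % n) := by
  nontriviality R
  have hmonic : (X ^ n - 1 : R[X]).Monic := monic_X_pow_sub_C 1 hn
  rw [← sub_eq_zero, ← (modByMonic_eq_self_iff hmonic (p := X ^ (s % n))).2, ← sub_modByMonic,
    modByMonic_eq_zero_iff_dvd hmonic]
  · have hs : (X ^ s : R[X]) = X ^ (s % n) * (X ^ n) ^ (s / n) := by
      rw [← pow_mul, ← pow_add, Nat.mod_add_div]
    have : (X ^ n - 1 : R[X]) ∣ (X ^ n) ^ (s / n) - 1 := by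
      simpa using sub_dvd_pow_sub_pow (X ^ n : R[X]) 1 (s / n)
    simpa [hs, mul_sub] using this.mul_left (X ^ (s % n))
  · have h : (X ^ n - 1 : R[X]).degree = n := degree_X_pow_sub_C (Nat.pos_of_ne_zero hn) 1
    rw [h, degree_X_pow]
    exact_mod_cast Nat.mod_lt s (Nat.pos_of_ne_zero hn)

theorem wronskian_X_pow_monomial {R : Type*} [CommRing R] (q r : ℕ) (a : R) :
    wronskian (X ^ q) (monomial r a) = (((r : R) - q) * a) • X ^ (q + r - 1) := by
  rw [wronskian, derivative_monomial, derivative_X_pow, ← C_mul_X_pow_eq_monomial,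
    ← C_mul_X_pow_eq_monomial, smul_eq_C_mul]
  simp only [C_mul, C_sub]
  rcases Nat.eq_zero_or_pos q with rfl | hq <;> rcases Nat.eq_zero_or_pos r with rfl | hr
  · simp
  · simp; ring
  · simp
  · obtain ⟨q, rfl⟩ := Nat.exists_eq_add_of_lt hq
    obtain ⟨r, rfl⟩ := Nat.exists_eq_add_of_lt hr
    simp only [zero_add, Nat.add_sub_cancel, show q + 1 + (r + 1) - 1 = q + r + 1 by omega]
    ring

/-- Differentiation lowers the exponent by one, which matches diagonals numbered from 1. The
hypothesis avoids truncated subtraction at q = r = 0, where the coefficient r - q vanishes anyway.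
-/
theorem brokenDiag_condition_iff {n : ℕ} (p q : Fin n) {r : ℕ} (h : 0 < (q : ℕ) + r) :
    ((p : ℕ) + 1 = resOne r n + q ∨ (p : ℕ) + 1 + n = resOne r n + q) ↔
      ((q : ℕ) + r - 1) % n = p := by
  have hp := p.2
  have hq := q.2
  have hn : 0 < n := p.pos
  have hr := Nat.mod_add_div r n
  have hrn := Nat.mod_lt r hn
  generalize r / n = c at hr
  have key : ∀ t b, t < n → (q : ℕ) + r - 1 = t + n * b → ((q : ℕ) + r - 1) % n = t := by
    intro t b ht hb
    rw [hb, Nat.add_mul_mod_self_left, Nat.mod_eq_of_lt ht]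
  unfold resOne
  split_ifs with h0
  · rw [h0, zero_add] at hr
    rcases Nat.eq_zero_or_pos (q : ℕ) with hq0 | hq0
    · have hc : 1 ≤ c := by
        by_contra hc
        have hc0 : c = 0 := by omega
        have : n * c = 0 := by rw [hc0, mul_zero]
        omega
      obtain ⟨d, hd⟩ := Nat.exists_eq_add_of_le hc
      rw [key (n - 1) d (by omega) (by
        have : n * c = n + n * d := by rw [hd]; ring
        omega)]
      omega
    · rw [key (q - 1) c (by omega) (by omega)]
      omega
  · by_cases hlt : r % n + q ≤ n
    · rw [key (r % n + q - 1) c (by omega) (by omega)]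
      omega
    · rw [key (r % n + q - 1 - n) (c + 1) (by omega) (by
        have : n * (c + 1) = n * c + n := by ring
        omega)]
      omega

theorem wronskianMatrix_X_pow_sub_one {R : Type*} [CommRing R] (n : ℕ) (Q : R[X]) :
    wronskianMatrix n (X ^ n - 1) Q = ∑ r ∈ Finset.range (Q.natDegree + 1),
      brokenDiag n (resOne r n) fun k : Fin n => ((r : R) - ((k : ℕ) : R)) * Q.coeff r := by
  ext p q
  have hn : n ≠ 0 := p.pos.ne'
  have hQ : wronskian (X ^ (q : ℕ)) Q = ∑ r ∈ Finset.range (Q.natDegree + 1),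
      (((r : R) - (q : ℕ)) * Q.coeff r) • X ^ ((q : ℕ) + r - 1) := by
    conv_lhs => rw [Q.as_sum_range]
    rw [← wronskianBilin_apply, map_sum]
    exact Finset.sum_congr rfl fun r _ => wronskian_X_pow_monomial _ _ _
  rw [wronskianMatrix, Matrix.of_apply, hQ, Matrix.sum_apply]
  change (modByMonicHom _ _).coeff _ = _
  rw [map_sum, finsetSum_coeff]
  refine Finset.sum_congr rfl fun r _ => ?_
  rw [map_smul, modByMonicHom_apply, X_pow_modByMonic_X_pow_sub_one hn, coeff_smul, coeff_X_pow,
    brokenDiag, Matrix.of_apply, smul_eq_mul, mul_ite, mul_one, mul_zero]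
  rcases Nat.eq_zero_or_pos ((q : ℕ) + r) with h | h
  · obtain ⟨h1, h2⟩ := Nat.add_eq_zero_iff.1 h
    simp [h1, h2]
  · simp only [brokenDiag_condition_iff p q h, eq_comm (a := (p : ℕ))]

/-! ### Root multisets and conclusion -/

theorem Multiset.prod_univ_coe_eq {α M : Type*} [DecidableEq α] [CommMonoid M] (m : Multiset α)
    (f : α → M) : ∏ a : m.ToType, f a.1 = (m.map f).prod := by
  conv_rhs => rw [← Multiset.map_univ_coe m, Multiset.map_map]
  rfl

theorem Polynomial.Splits.eq_C_mul_nodal {K : Type*} [Field K] [DecidableEq K] {Q : K[X]}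
    (hQ : Q.Splits) :
    Q = C Q.leadingCoeff * Lagrange.nodal Finset.univ fun y : Q.roots.ToType => y.1 := by
  conv_lhs => rw [hQ.eq_prod_roots]
  rw [Lagrange.nodal, Multiset.prod_univ_coe_eq Q.roots fun a => X - C a]

theorem rectPermanent_eq_sum {ι ι' κ R : Type*} [Fintype ι] [Fintype ι'] [Fintype κ]
    [DecidableEq ι] [DecidableEq ι'] [DecidableEq κ] [CommSemiring R] (A : Matrix ι κ R)
    (e : ι' ≃ ι) : rectPermanent A = ∑ f : ι' ↪ κ, ∏ i, A (e i) (f i) := by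
  rw [rectPermanent]
  refine (Fintype.sum_equiv (Equiv.embeddingCongr e (Equiv.refl κ)) _ _ fun f => ?_).symm
  rw [← e.prod_comp]
  simp

open Classical in
theorem scottPermanent_eq_sum {K : Type*} [Field K] {n : ℕ} (P Q : K[X])
    (e : Fin n ≃ P.roots.ToType) :
    scottPermanent P Q = ∑ f : Fin n ↪ Q.roots.ToType, ∏ i, ((e i).1 - (f i).1)⁻¹ := by
  simp_rw [scottPermanent, rectPermanent_eq_sum _ e, Matrix.of_apply, one_div]

theorem theorem3 {K : Type*} [Field K] (n : ℕ) (hn : 1 ≤ n) (Q : K[X])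
    (hP : (X ^ n - 1 : K[X]).Splits) (hQ : Q.Splits)
    (hPQ : ∀ z : K, (X ^ n - 1 : K[X]).IsRoot z → ¬ Q.IsRoot z) :
    resultant (X ^ n - 1) Q ≠ 0 ∧
      scottPermanent (X ^ n - 1) Q = fes n Q / resultant (X ^ n - 1) Q := by
  classical
  have hdeg : (X ^ n - 1 : K[X]).natDegree = n := natDegree_X_pow_sub_C (r := (1 : K))
  have hmonic : (X ^ n - 1 : K[X]).Monic := monic_X_pow_sub_C 1 (by omega)
  have hcard : Fintype.card (X ^ n - 1 : K[X]).roots.ToType = n := by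
    rw [Multiset.card_coe, ← hP.natDegree_eq_card_roots, hdeg]
  let e : Fin n ≃ (X ^ n - 1 : K[X]).roots.ToType := (Fintype.equivFinOfCardEq hcard).symm
  set x : Fin n → K := fun i => (e i).1 with hx
  set y : Q.roots.ToType → K := fun j => j.1 with hy
  have hPx : (X ^ n - 1 : K[X]) = Lagrange.nodal Finset.univ x := by
    conv_lhs => rw [hP.eq_C_mul_nodal, hmonic.leadingCoeff, C_1, one_mul]
    exact (e.prod_comp (fun z => X - C z.1)).symm
  have hQy : Q = C Q.leadingCoeff * Lagrange.nodal Finset.univ y := hQ.eq_C_mul_nodal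
  have hxQ : ∀ i, eval (x i) Q ≠ 0 := fun i => hPQ _ (by
    rw [IsRoot.def, hPx, Lagrange.eval_nodal_at_node (Finset.mem_univ i)])
  have heval : ∀ i, eval (x i) Q = Q.leadingCoeff * ∏ j, (x i - y j) := fun i => by
    conv_lhs => rw [hQy]
    rw [eval_mul, eval_C, Lagrange.eval_nodal]
  have hxy : ∀ i j, x i - y j ≠ 0 := fun i j h => hxQ i (by
    rw [heval, Finset.prod_eq_zero (Finset.mem_univ j) h, mul_zero])
  have hres : resultant (X ^ n - 1) Q = ∏ i, eval (x i) Q := by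
    rw [resultant_eq_prod_eval _ _ _ le_rfl hP, hmonic.leadingCoeff, one_pow, one_mul,
      ← e.symm.prod_comp]
    rw [← Multiset.prod_univ_coe_eq]
    simp [x]
  have hres0 : resultant (X ^ n - 1) Q ≠ 0 := by
    rw [hres, Finset.prod_ne_zero_iff]
    exact fun i _ => hxQ i
  refine ⟨hres0, ?_⟩
  rw [eq_div_iff hres0, fes, ← wronskianMatrix_X_pow_sub_one, hres, scottPermanent_eq_sum _ _ e]
  conv_rhs => rw [hPx, hQy, wronskianMatrix_C_mul, Matrix.det_smul, Fintype.card_fin,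
    Matrix.det_wronskianMatrix_nodal_nodal]
  -- Both sides now carry the n-th power of the leading coefficient; in each summand the factor j =
  -- f i of Q(x i) cancels the inverse.
  simp_rw [heval]
  rw [Finset.prod_mul_distrib, Finset.prod_const, Finset.card_univ, Fintype.card_fin,
    mul_left_comm, Finset.sum_mul]
  congr 1
  refine Finset.sum_congr rfl fun f _ => ?_
  rw [← Finset.prod_mul_distrib]
  refine Finset.prod_congr rfl fun i _ => ?_
  rw [← Finset.mul_prod_erase _ _ (Finset.mem_univ (f i)), inv_mul_cancel_left₀ (hxy _ _)]
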